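/- An overpartition of an integer $n\ge 0$ is a non-increasing finite sequence of positive integers (parts) $d_1\ge d_2\ge\cdots\ge d_s$ with sum $n$ (for $n=0$, the empty sequence), in which the first occurrence of each integer may be overlined (the overlining carries no numerical weight, and all other occurrences are non-overlined). For integers $k\ge i\ge 1$ and $n\ge 0$, let $D_{k,i}(n)$ denote the number of overpartitions $d_1+d_2+\cdots+d_s$ of $n$ such that $1$ occurs as a non-overlined part at most $i-1$ times and such that, for all $1\le j\le s-k+1$, one has $d_j-d_{j+k-1}\ge 1$ if $d_j$ is overlined and $d_j-d_{j+k-1}\ge 2$ otherwise. For $k>i\ge 1$, let $C_{k,i}(n)$ denote the number of overpartitions of $n$ whose non-overlined parts are not congruent to $0,\pm i$ modulo $2k$, and let $C_{k,k}(n)$ denote the number of overpartitions of $n$ none of whose parts, overlined or non-overlined, is divisible by $k$. Then for all $k\ge i\ge 1$ and all $n\ge 0$, $$C_{k,i}(n)=D_{k,i}(n).$$ -/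

import Mathlib

/-- An overpartition of `n`: a non-increasing finite sequence of positive integers with sum `n`,
in which the first occurrence of each integer may be overlined. An entry `(a, true)` is the
overlined part `a`, an entry `(a, false)` is the non-overlined part `a`. -/
@[ext]
structure Overpartition (n : ℕ) where
  /-- The parts `d₁, d₂, …, d_s`, in the order in which they are written. -/
  parts : List (ℕ × Bool)
  pos : ∀ p ∈ parts, 0 < p.1
  sorted : parts.Pairwise (fun p q => q.1 ≤ p.1)
  /-- A part that is preceded by a part of the same size is not overlined. -/
  overlined_first : parts.Pairwise (fun p q => p.1 = q.1 → q.2 = false)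
  sum_eq : (parts.map Prod.fst).sum = n

namespace Overpartition

/-- There are finitely many overpartitions of `n`, so that `Nat.card` below really counts. -/
instance finite (n : ℕ) : Finite (Overpartition n) := by
  have hlen : ∀ l : List (ℕ × Bool), (∀ p ∈ l, 0 < p.1) →
      l.length ≤ (l.map Prod.fst).sum := by
    intro l
    induction l with
    | nil => simp
    | cons a l ih =>
      intro h
      have h1 := h a (by simp)
      have h2 := ih (fun p hp => h p (by simp [hp]))
      simp only [List.length_cons, List.map_cons, List.sum_cons]
      omega
  have hle : ∀ (o : Overpartition n), ∀ p ∈ o.parts, p.1 < n + 1 := by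
    intro o p hp
    have h := List.single_le_sum (l := o.parts.map Prod.fst) (by simp) p.1
      (List.mem_map_of_mem hp)
    rw [o.sum_eq] at h
    omega
  have hfin : Finite {l : List (Fin (n + 1) × Bool) | l.length ≤ n} :=
    (List.finite_length_le (Fin (n + 1) × Bool) n).to_subtype
  let g : Overpartition n → {l : List (Fin (n + 1) × Bool) | l.length ≤ n} := fun o =>
    ⟨o.parts.map (fun p => (Fin.ofNat (n + 1) p.1, p.2)), by
      have h := hlen o.parts o.pos
      rw [o.sum_eq] at h
      simpa using h⟩
  refine Finite.of_injective g ?_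
  intro o₁ o₂ h
  have hback : ∀ o : Overpartition n,
      (g o).1.map (fun p => ((p.1 : ℕ), p.2)) = o.parts := by
    intro o
    simp only [g, List.map_map]
    conv_rhs => rw [← List.map_id o.parts]
    refine List.map_congr_left ?_
    intro p hp
    simp [Nat.mod_eq_of_lt (hle o p hp)]
  apply Overpartition.ext
  rw [← hback o₁, ← hback o₂, h]

/-- The non-overlined part `1` occurs at most `i - 1` times, and `d_j - d_{j+k-1} ≥ 1` if `d_j` is
overlined, `d_j - d_{j+k-1} ≥ 2` otherwise, for all `j` such that `d_j` and `d_{j+k-1}` exist. -/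
def DifferenceCondition (k i : ℕ) {n : ℕ} (o : Overpartition n) : Prop :=
  o.parts.count (1, false) ≤ i - 1 ∧
  ∀ (j : ℕ) (h : j + (k - 1) < o.parts.length),
    ((o.parts[j]).1 : ℤ) - ((o.parts[j + (k - 1)]).1 : ℤ) ≥
      if (o.parts[j]).2 = true then 1 else 2

/-- For `i ≠ k`: no non-overlined part is congruent to `0`, `i` or `-i` modulo `2k`.
For `i = k`: no part, overlined or not, is divisible by `k`. -/
def CongruenceCondition (k i : ℕ) {n : ℕ} (o : Overpartition n) : Prop :=
  if i = k then
    ∀ p ∈ o.parts, ¬ k ∣ p.1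
  else
    ∀ p ∈ o.parts, p.2 = false →
      ¬ (p.1 : ℤ) ≡ 0 [ZMOD 2 * k] ∧
      ¬ (p.1 : ℤ) ≡ i [ZMOD 2 * k] ∧
      ¬ (p.1 : ℤ) ≡ -i [ZMOD 2 * k]

/-- The number `D_{k,i}(n)`. -/
noncomputable def countD (k i n : ℕ) : ℕ :=
  Nat.card {o : Overpartition n // o.DifferenceCondition k i}

/-- The number `C_{k,i}(n)`. -/
noncomputable def countC (k i n : ℕ) : ℕ :=
  Nat.card {o : Overpartition n // o.CongruenceCondition k i}

end Overpartition

open Finset PowerSeries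

/-!
Removing the smallest parts of an overpartition shows that the generating functions of the
difference condition, refined by a lower bound `m` on the parts, satisfy a recurrence which,
together with their behaviour for large `m`, determines them. Andrews' functions
`H_{k,i}(-1/q; q^{m+1}; q)` satisfy the same recurrence; at `m = 0` their series is a theta series,
which Jacobi's triple product identity turns into the product that generates the congruence
condition.

Coefficients of `X ^ j` with `j ≤ n` are compared modulo `X ^ (n + 1)`, so that the base `q` is
nilpotent: infinite series and products become finite, and the initial values are taken at
`m = n + 1`.
-/

section QPochhammer

variable {R : Type*} [CommRing R]

/-- The `q`-Pochhammer symbol `(a; q)_n`. Where `q ^ N = 0`, the symbol `(a; q)_N` plays the role of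
the infinite product `(a; q)_∞`. -/
def qPochhammer (a q : R) (n : ℕ) : R := ∏ j ∈ range n, (1 - a * q ^ j)

theorem qPochhammer_zero (a q : R) : qPochhammer a q 0 = 1 := prod_range_zero _

theorem qPochhammer_succ (a q : R) (n : ℕ) :
    qPochhammer a q (n + 1) = qPochhammer a q n * (1 - a * q ^ n) :=
  prod_range_succ _ _

theorem qPochhammer_add (a q : R) (m n : ℕ) :
    qPochhammer a q (m + n) = qPochhammer a q m * qPochhammer (a * q ^ m) q n := by
  simp only [qPochhammer, prod_range_add, pow_add, mul_assoc]

theorem qPochhammer_succ' (a q : R) (n : ℕ) :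
    qPochhammer a q (n + 1) = (1 - a) * qPochhammer (a * q) q n := by
  rw [add_comm, qPochhammer_add, pow_one, qPochhammer_succ, qPochhammer_zero, one_mul, pow_zero,
    mul_one]

theorem qPochhammer_zero_left (q : R) (n : ℕ) : qPochhammer 0 q n = 1 := by
  simp [qPochhammer]

theorem qPochhammer_eq_of_le {q : R} {N L : ℕ} (hq : q ^ N = 0) (hNL : N ≤ L) (a : R) :
    qPochhammer a q L = qPochhammer a q N := by
  obtain ⟨d, rfl⟩ := Nat.exists_eq_add_of_le hNL
  rw [qPochhammer_add, hq, mul_zero, qPochhammer_zero_left, mul_one]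

theorem qPochhammer_eq_one_sub_mul {q : R} {N : ℕ} (hq : q ^ N = 0) (a : R) :
    qPochhammer a q N = (1 - a) * qPochhammer (a * q) q N := by
  rw [← qPochhammer_succ', qPochhammer_eq_of_le hq N.le_succ]

theorem isUnit_qPochhammer {a : R} (ha : IsNilpotent a) (q : R) (n : ℕ) :
    IsUnit (qPochhammer a q n) :=
  IsUnit.prod_iff.mpr fun _ _ => ((Commute.all _ _).isNilpotent_mul_right ha).isUnit_one_sub

theorem qPochhammer_mul_qPochhammer_neg (a q : R) (n : ℕ) :
    qPochhammer a q n * qPochhammer (-a) q n = qPochhammer (a ^ 2) (q ^ 2) n := by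
  simp only [qPochhammer, ← prod_mul_distrib]
  exact prod_congr rfl fun j _ => by ring

theorem qPochhammer_two_mul (a q : R) (n : ℕ) :
    qPochhammer a q (2 * n) = qPochhammer a (q ^ 2) n * qPochhammer (a * q) (q ^ 2) n := by
  induction n with
  | zero => simp [qPochhammer]
  | succ n ih =>
    rw [Nat.mul_succ, qPochhammer_succ, qPochhammer_succ, ih, qPochhammer_succ, qPochhammer_succ]
    ring

theorem qPochhammer_self_eq_mul {q : R} {N : ℕ} (hq : q ^ N = 0) :
    qPochhammer q q N = qPochhammer q (q ^ 2) N * qPochhammer (q ^ 2) (q ^ 2) N := by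
  rw [← qPochhammer_eq_of_le hq (Nat.le_mul_of_pos_left N two_pos), qPochhammer_two_mul, sq]

/-- **Euler**: partitions into distinct parts and into odd parts are equinumerous. -/
theorem qPochhammer_neg_self_mul_odd {q : R} {N : ℕ} (hq : q ^ N = 0) :
    qPochhammer (-q) q N * qPochhammer q (q ^ 2) N = 1 := by
  have hunit : IsUnit (qPochhammer (q ^ 2) (q ^ 2) N) :=
    isUnit_qPochhammer (IsNilpotent.pow_of_pos ⟨N, hq⟩ two_ne_zero) _ _
  refine hunit.mul_right_cancel ?_
  linear_combination qPochhammer_mul_qPochhammer_neg q q N -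
    qPochhammer (-q) q N * qPochhammer_self_eq_mul hq

end QPochhammer

section CongruenceProducts

variable {R : Type*} [CommRing R]

theorem prod_modEq_one_sub_mul_pow (x q : R) {c r : ℕ} (hr : 1 ≤ r)
    (hrc : r ≤ c) (N : ℕ) : ∏ a ∈ Icc 1 (c * N) with a ≡ r [MOD c], (1 - x * q ^ a) =
      qPochhammer (x * q ^ r) (q ^ c) N := by
  have himage : {a ∈ Icc 1 (c * N) | a ≡ r [MOD c]} = (range N).image (r + c * ·) := by
    ext a
    simp only [mem_filter, mem_Icc, mem_image, mem_range]
    constructor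
    · rintro ⟨⟨ha, haN⟩, hmod⟩
      obtain ⟨j, rfl | rfl⟩ : ∃ j, a = r + c * j ∨ r = a + c * j := by
        rcases Nat.le_total r a with hle | hle
        · obtain ⟨j, hj⟩ := (Nat.modEq_iff_dvd' hle).mp hmod.symm
          exact ⟨j, Or.inl (by omega)⟩
        · obtain ⟨j, hj⟩ := (Nat.modEq_iff_dvd' hle).mp hmod
          exact ⟨j, Or.inr (by omega)⟩
      · exact ⟨j, by nlinarith, rfl⟩
      · obtain rfl : j = 0 := by nlinarith
        exact ⟨0, by grind, by simp⟩
    · rintro ⟨j, hj, rfl⟩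
      exact ⟨⟨by omega, by nlinarith⟩, by simp [Nat.ModEq]⟩
  rw [himage, prod_image, qPochhammer]
  · simp only [pow_add, pow_mul, mul_assoc]
  · exact fun j _ j' _ h => Nat.eq_of_mul_eq_mul_left (by omega) (Nat.add_left_cancel h)

theorem prod_modEq_one_sub_pow (q : R) {c r : ℕ} (hr : 1 ≤ r)
    (hrc : r ≤ c) (N : ℕ) : ∏ a ∈ Icc 1 (c * N) with a ≡ r [MOD c], (1 - q ^ a) =
      qPochhammer (q ^ r) (q ^ c) N := by
  simpa using prod_modEq_one_sub_mul_pow 1 q hr hrc N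

theorem prod_modEq_one_add_pow (q : R) {c r : ℕ} (hr : 1 ≤ r)
    (hrc : r ≤ c) (N : ℕ) : ∏ a ∈ Icc 1 (c * N) with a ≡ r [MOD c], (1 + q ^ a) =
      qPochhammer (-q ^ r) (q ^ c) N := by
  simpa using prod_modEq_one_sub_mul_pow (-1) q hr hrc N

theorem prod_Icc_one_sub_pow (q : R) (L : ℕ) :
    ∏ a ∈ Icc 1 L, (1 - q ^ a) = qPochhammer q q L := by
  simpa [Nat.modEq_one] using prod_modEq_one_sub_pow q le_rfl le_rfl L

theorem prod_Icc_one_add_pow (q : R) (L : ℕ) :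
    ∏ a ∈ Icc 1 L, (1 + q ^ a) = qPochhammer (-q) q L := by
  simpa [Nat.modEq_one] using prod_modEq_one_add_pow q le_rfl le_rfl L

theorem prod_modEq_or_one_sub_pow (q : R) {k i : ℕ} (hi : 1 ≤ i)
    (hik : i < k) (N : ℕ) :
    ∏ a ∈ Icc 1 (2 * k * N) with
        a ≡ i [MOD 2 * k] ∨ a ≡ 2 * k - i [MOD 2 * k] ∨ a ≡ 2 * k [MOD 2 * k], (1 - q ^ a) =
      qPochhammer (q ^ i) (q ^ (2 * k)) N * qPochhammer (q ^ (2 * k - i)) (q ^ (2 * k)) N *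
        qPochhammer (q ^ (2 * k)) (q ^ (2 * k)) N := by
  have not_modEq {a r s : ℕ} (hr : 1 ≤ r) (hrs : r < s) (hs : s ≤ 2 * k)
      (har : a ≡ r [MOD 2 * k]) : ¬a ≡ s [MOD 2 * k] := fun has => by
    have hdvd := (Nat.modEq_iff_dvd' hrs.le).mp (har.symm.trans has)
    exact absurd (Nat.le_of_dvd (by omega) hdvd) (by omega)
  rw [filter_or, prod_union, filter_or, prod_union, ← mul_assoc, prod_modEq_one_sub_pow,
    prod_modEq_one_sub_pow, prod_modEq_one_sub_pow]
  any_goals omega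
  · exact disjoint_filter.mpr fun a _ => not_modEq (by omega) (by omega) le_rfl
  · exact disjoint_filter.mpr fun a _ ha => not_or.mpr
      ⟨not_modEq hi (by omega) (by omega) ha, not_modEq hi (by omega) le_rfl ha⟩

end CongruenceProducts

section GaussBinom

variable {R : Type*} [CommRing R]

/-- The Gaussian binomial coefficient `[u + v; u]` with base `s`, defined by Pascal's rule so that
no division is needed. -/
def gaussBinom (s : R) : ℕ → ℕ → R
  | 0, _ => 1
  | _ + 1, 0 => 1
  | u + 1, v + 1 => gaussBinom s u (v + 1) + s ^ (u + 1) * gaussBinom s (u + 1) v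

theorem gaussBinom_zero_left (s : R) (v : ℕ) : gaussBinom s 0 v = 1 := by
  rw [gaussBinom]

theorem gaussBinom_zero_right (s : R) (u : ℕ) : gaussBinom s u 0 = 1 := by
  cases u <;> rw [gaussBinom]

theorem gaussBinom_succ_succ (s : R) (u v : ℕ) : gaussBinom s (u + 1) (v + 1) =
    gaussBinom s u (v + 1) + s ^ (u + 1) * gaussBinom s (u + 1) v := by
  rw [gaussBinom]

theorem one_sub_pow_mul_gaussBinom (s : R) (u v : ℕ) :
    (1 - s ^ (u + 1)) * gaussBinom s (u + 1) v = (1 - s ^ (u + v + 1)) * gaussBinom s u v ∧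
      (1 - s ^ (v + 1)) * gaussBinom s u (v + 1) = (1 - s ^ (u + v + 1)) * gaussBinom s u v := by
  induction u generalizing v with
  | zero =>
    have left (v : ℕ) : (1 - s) * gaussBinom s 1 v = 1 - s ^ (v + 1) := by
      induction v with
      | zero => simp [gaussBinom_zero_right]
      | succ v ih =>
        rw [gaussBinom_succ_succ, gaussBinom_zero_left]
        linear_combination s * ih
    simp [gaussBinom_zero_left, left]
  | succ u ihu =>
    have right (v : ℕ) : (1 - s ^ (v + 1)) * gaussBinom s (u + 1) (v + 1) =
        (1 - s ^ (u + 1 + v + 1)) * gaussBinom s (u + 1) v := by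
      rw [gaussBinom_succ_succ]
      linear_combination (ihu v).2 - (ihu v).1
    refine ⟨?_, right v⟩
    induction v with
    | zero => simp [gaussBinom_zero_right]
    | succ v ihv =>
      rw [gaussBinom_succ_succ]
      linear_combination s ^ (u + 1 + 1) * ihv - s ^ (u + 1 + 1) * right v

theorem gaussBinom_mul_qPochhammer (s : R) (u v : ℕ) :
    gaussBinom s u v * qPochhammer s s u = qPochhammer (s ^ (v + 1)) s u := by
  induction u with
  | zero => simp [gaussBinom_zero_left, qPochhammer_zero]
  | succ u ih =>
    rw [qPochhammer_succ, qPochhammer_succ, ← ih]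
    linear_combination qPochhammer s s u * (one_sub_pow_mul_gaussBinom s u v).1

theorem gaussBinom_succ_succ' (s : R) (u v : ℕ) : gaussBinom s (u + 1) (v + 1) =
    gaussBinom s (u + 1) v + s ^ (v + 1) * gaussBinom s u (v + 1) := by
  obtain ⟨h₁, h₂⟩ := one_sub_pow_mul_gaussBinom s u v
  rw [gaussBinom_succ_succ]
  linear_combination h₂ - h₁

theorem gaussBinom_comm (s : R) (u v : ℕ) : gaussBinom s u v = gaussBinom s v u := by
  induction u generalizing v with
  | zero => rw [gaussBinom_zero_left, gaussBinom_zero_right]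
  | succ u ihu =>
    induction v with
    | zero => rw [gaussBinom_zero_left, gaussBinom_zero_right]
    | succ v ihv => rw [gaussBinom_succ_succ, gaussBinom_succ_succ', ihu, ihv]

theorem sum_antidiagonal_mul_gaussBinom (s : R) (f : ℕ → ℕ → R) (n : ℕ) :
    ∑ p ∈ antidiagonal (n + 1), f p.1 p.2 * gaussBinom s p.1 p.2 =
      ∑ p ∈ antidiagonal n,
        (f (p.1 + 1) p.2 + s ^ p.1 * f p.1 (p.2 + 1)) * gaussBinom s p.1 p.2 := by
  simp only [add_mul, sum_add_distrib]
  cases n with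
  | zero =>
    simp [Nat.sum_antidiagonal_succ, gaussBinom_zero_left, gaussBinom_zero_right, add_comm]
  | succ n =>
    rw [Nat.sum_antidiagonal_succ, Nat.sum_antidiagonal_succ', Nat.sum_antidiagonal_succ' (n := n),
      Nat.sum_antidiagonal_succ (n := n)]
    simp only [gaussBinom_succ_succ, gaussBinom_zero_left, gaussBinom_zero_right, mul_add,
      sum_add_distrib, mul_left_comm (f _ _), mul_assoc]
    ring

theorem sum_antidiagonal_mul_gaussBinom' (s : R) (f : ℕ → ℕ → R) (n : ℕ) :
    ∑ p ∈ antidiagonal (n + 1), f p.1 p.2 * gaussBinom s p.1 p.2 =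
      ∑ p ∈ antidiagonal n,
        (f p.1 (p.2 + 1) + s ^ p.2 * f (p.1 + 1) p.2) * gaussBinom s p.1 p.2 := by
  rw [← Nat.sum_antidiagonal_swap, ← Nat.sum_antidiagonal_swap (n := n)]
  simpa only [Prod.fst_swap, Prod.snd_swap, gaussBinom_comm] using
    sum_antidiagonal_mul_gaussBinom s (fun u v => f v u) n

end GaussBinom

section TripleProduct

variable {R : Type*} [CommRing R]

/-- The term `(-1)^n a^{n(n+1)/2} b^{n(n-1)/2}` of Ramanujan's theta function `f(-a, -b)`. -/
def thetaTerm (a b : R) : ℤ → R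
  | .ofNat n => (-a) ^ n * (a * b) ^ n.choose 2
  | .negSucc n => (-b) ^ (n + 1) * (a * b) ^ (n + 1).choose 2

theorem thetaTerm_natCast (a b : R) (n : ℕ) :
    thetaTerm a b n = (-a) ^ n * (a * b) ^ n.choose 2 := rfl

theorem thetaTerm_neg (a b : R) (n : ℤ) : thetaTerm a b (-n) = thetaTerm b a n := by
  rcases n with (_ | n) | n
  · simp [thetaTerm]
  · exact congrArg (_ * · ^ _) (mul_comm a b)
  · exact congrArg (_ * · ^ _) (mul_comm a b)

theorem thetaTerm_natCast_succ (a b : R) (n : ℕ) :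
    thetaTerm a b (n + 1) = -(a * (a * b) ^ n * thetaTerm a b n) := by
  rw [← Nat.cast_add_one, thetaTerm_natCast, thetaTerm_natCast, Nat.choose_succ_succ' n 1,
    Nat.choose_one_right]
  ring

theorem thetaTerm_add_one_mul_pow (a b : R) {n : ℤ} {r u : ℕ} (h : u + n = r) :
    thetaTerm a b (n + 1) * (a * b) ^ u = -(a * (a * b) ^ r * thetaTerm a b n) := by
  rcases n with n | n
  · obtain rfl : r = u + n := by rw [Int.ofNat_eq_natCast] at h; omega
    simp only [Int.ofNat_eq_natCast, thetaTerm_natCast_succ]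
    ring
  · obtain rfl : u = r + (n + 1) := by rw [Int.negSucc_eq] at h; omega
    rw [Int.negSucc_eq, thetaTerm_neg, thetaTerm_natCast_succ,
      show -((n : ℤ) + 1) + 1 = -n by ring, thetaTerm_neg]
    ring

theorem thetaTerm_sub_one_mul_pow (a b : R) {n : ℤ} {r u : ℕ} (h : u = r + n) :
    thetaTerm a b (n - 1) * (a * b) ^ u = -(b * (a * b) ^ r * thetaTerm a b n) := by
  have hneg := thetaTerm_add_one_mul_pow b a (n := -n) (r := r) (u := u) (by omega)
  rwa [show -n + 1 = -(n - 1) by ring, thetaTerm_neg, thetaTerm_neg, mul_comm b a] at hneg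

/-- The finite form of Jacobi's triple product identity. -/
theorem qPochhammer_mul_qPochhammer_eq_sum (a b : R) (M N : ℕ) :
    qPochhammer a (a * b) M * qPochhammer b (a * b) N =
      ∑ p ∈ antidiagonal (M + N), thetaTerm a b (p.2 - N) * gaussBinom (a * b) p.1 p.2 := by
  induction N with
  | zero =>
    induction M with
    | zero => simp [qPochhammer_zero, gaussBinom_zero_left, thetaTerm]
    | succ M ih =>
      rw [qPochhammer_succ, mul_right_comm, ih, add_right_comm,
        sum_antidiagonal_mul_gaussBinom _ (fun _ v => thetaTerm a b (v - (0 : ℕ))), sum_mul]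
      refine sum_congr rfl fun p hp => ?_
      have hstep := thetaTerm_add_one_mul_pow a b (n := p.2) (r := M) (u := p.1)
        (by exact_mod_cast mem_antidiagonal.mp hp)
      simp only [Nat.cast_zero, sub_zero, Nat.cast_succ]
      linear_combination -gaussBinom (a * b) p.1 p.2 * hstep
  | succ N ih =>
    rw [qPochhammer_succ, ← mul_assoc, ih, ← add_assoc,
      sum_antidiagonal_mul_gaussBinom' _ (fun _ v => thetaTerm a b (v - (N + 1 : ℕ))), sum_mul]
    refine sum_congr rfl fun p _ => ?_
    have hstep := thetaTerm_sub_one_mul_pow a b (n := p.2 - N) (r := N) (u := p.2) (by ring)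
    rw [Nat.cast_succ, Nat.cast_succ, add_sub_add_right_eq_sub, ← sub_sub]
    linear_combination -gaussBinom (a * b) p.1 p.2 * hstep

theorem mul_qPochhammer_eq_self {a c : R} (h : c * a = 0) (q : R) (n : ℕ) :
    c * qPochhammer a q n = c := by
  induction n with
  | zero => rw [qPochhammer_zero, mul_one]
  | succ n ih =>
    rw [qPochhammer_succ, ← mul_assoc, ih, mul_sub, mul_one, ← mul_assoc, h, zero_mul, sub_zero]

theorem pow_mul_gaussBinom_mul_qPochhammer {s : R} {N e u v : ℕ} (hs : s ^ N = 0)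
    (hu : N ≤ e + (u + 1)) (hv : N ≤ e + (v + 1)) :
    s ^ e * (gaussBinom s u v * qPochhammer s s N) = s ^ e := by
  have hzero (w : ℕ) (hw : N ≤ e + (w + 1)) : s ^ e * s ^ (w + 1) = 0 := by
    rw [← pow_add, pow_eq_zero_of_le hw hs]
  rw [← qPochhammer_eq_of_le hs (Nat.le_add_left N u), qPochhammer_add,
    ← mul_assoc (gaussBinom _ _ _), gaussBinom_mul_qPochhammer, ← mul_assoc,
    mul_qPochhammer_eq_self (hzero v hv), ← pow_succ',
    mul_qPochhammer_eq_self (hzero u hu)]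

theorem thetaTerm_mul_gaussBinom_mul_qPochhammer {a b : R} {N u v : ℕ} (hab : (a * b) ^ N = 0)
    (huv : u + v = 2 * N + 1) :
    thetaTerm a b (v - N) * (gaussBinom (a * b) u v * qPochhammer (a * b) (a * b) N) =
      thetaTerm a b (v - N) := by
  have le_choose (d : ℕ) : d ≤ d.choose 2 + 1 := by
    cases d with
    | zero => exact Nat.zero_le _
    | succ d =>
      rw [Nat.choose_succ_succ' d 1, Nat.choose_one_right]
      omega
  rcases Nat.le_total N v with hle | hle
  · obtain ⟨d, rfl⟩ := Nat.exists_eq_add_of_le hle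
    rw [Nat.cast_add, add_sub_cancel_left, thetaTerm_natCast, mul_assoc,
      pow_mul_gaussBinom_mul_qPochhammer hab] <;> grind
  · obtain ⟨d, rfl⟩ := Nat.exists_eq_add_of_le hle
    rw [Nat.cast_add, sub_add_cancel_left, thetaTerm_neg, thetaTerm_natCast, mul_comm b a,
      mul_assoc, pow_mul_gaussBinom_mul_qPochhammer hab] <;> grind

/-- **Jacobi's triple product identity**, for a base that is nilpotent. -/
theorem qPochhammer_triple_product {a b : R} {N : ℕ} (hab : (a * b) ^ N = 0) :
    qPochhammer a (a * b) N * qPochhammer b (a * b) N * qPochhammer (a * b) (a * b) N =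
      ∑ n ∈ range (N + 1), (thetaTerm a b (-n) + thetaTerm a b (n + 1)) := by
  rw [← qPochhammer_eq_of_le hab N.le_succ, qPochhammer_mul_qPochhammer_eq_sum, sum_mul]
  calc ∑ p ∈ antidiagonal (N + 1 + N), thetaTerm a b (p.2 - N) * gaussBinom (a * b) p.1 p.2 *
        qPochhammer (a * b) (a * b) N
      = ∑ p ∈ antidiagonal (N + 1 + N), thetaTerm a b (p.2 - N) :=
        sum_congr rfl fun p hp => by
          rw [mul_assoc, thetaTerm_mul_gaussBinom_mul_qPochhammer hab]
          linarith [mem_antidiagonal.mp hp]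
    _ = ∑ v ∈ range (N + 1 + (N + 1)), thetaTerm a b (v - N) := by
        rw [← Nat.sum_antidiagonal_swap]
        exact Nat.sum_antidiagonal_eq_sum_range_succ_mk (fun p => thetaTerm a b (p.1 - N)) _
    _ = _ := by
        rw [sum_range_add, ← sum_range_reflect, ← sum_add_distrib]
        refine sum_congr rfl fun n hn => congrArg₂ _ (congrArg _ ?_) (congrArg _ ?_)
        · have := mem_range.mp hn
          omega
        · push_cast
          ring

end TripleProduct

section AndrewsRecurrence

variable {R : Type*} [CommRing R]

/-- The recurrence that relates Andrews' functions `g i m = H_{k,i}(-1/q; q^{m+1}; q)` to each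
other. -/
structure SatisfiesAndrewsRecurrence (q : R) (k : ℕ) (g : ℕ → ℕ → R) : Prop where
  zero_left (m : ℕ) : g 0 m = 0
  succ_left {i : ℕ} (hik : i < k) (m : ℕ) : g (i + 1) m = g i m +
    q ^ ((m + 1) * i) * (g (k - i) (m + 1) + q ^ (m + 1) * g (k - i - 1) (m + 1))

namespace SatisfiesAndrewsRecurrence

theorem const_mul {q : R} {k : ℕ} {g : ℕ → ℕ → R} (hg : SatisfiesAndrewsRecurrence q k g) (c : R) :
    SatisfiesAndrewsRecurrence q k fun i m => c * g i m where
  zero_left m := by rw [hg.zero_left, mul_zero]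
  succ_left hik m := by
    rw [hg.succ_left hik]
    ring

theorem map {S : Type*} [CommRing S] {q : R} {k : ℕ} {g : ℕ → ℕ → R}
    (hg : SatisfiesAndrewsRecurrence q k g) (φ : R →+* S) :
    SatisfiesAndrewsRecurrence (φ q) k fun i m => φ (g i m) where
  zero_left m := by rw [hg.zero_left, map_zero]
  succ_left hik m := by
    rw [hg.succ_left hik]
    simp only [map_add, map_mul, map_pow]

theorem eq_of_eq {q : R} {k N : ℕ} {g h : ℕ → ℕ → R} (hg : SatisfiesAndrewsRecurrence q k g)
    (hh : SatisfiesAndrewsRecurrence q k h) (heq : ∀ i, 1 ≤ i → i ≤ k → g i N = h i N) {m : ℕ}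
    (hm : m ≤ N) {i : ℕ} (hik : i ≤ k) : g i m = h i m := by
  induction hm using Nat.decreasingInduction generalizing i with
  | self =>
    rcases Nat.eq_zero_or_pos i with rfl | hi
    · rw [hg.zero_left, hh.zero_left]
    · exact heq i hi hik
  | of_succ m _ ihm =>
    induction i with
    | zero => rw [hg.zero_left, hh.zero_left]
    | succ i ihi =>
      rw [hg.succ_left hik, hh.succ_left hik, ihi (Nat.le_of_succ_le hik), ihm (k.sub_le i),
        ihm ((k - i).sub_le 1 |>.trans (k.sub_le i))]

end SatisfiesAndrewsRecurrence

/-- The product `(-q; q)_n (q^{n+1}; q)_m (-q^{n+m+1}; q)_∞`, truncated at `N` factors. -/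
def andrewsCoeff (q : R) (N n m : ℕ) : R :=
  qPochhammer (-q) q n * qPochhammer (q ^ (n + 1)) q m * qPochhammer (-q ^ (n + m + 1)) q N

/-- The `n`-th term of the series of Andrews' function `H_{k,i}(-1/q; q^{m+1}; q)`,
multiplied by `(q; q)_∞` to clear the denominators. -/
def andrewsTerm (q : R) (N k i m n : ℕ) : R :=
  (-1) ^ n * q ^ (m * k * n + k * n ^ 2 + (k - i) * n) * (1 - q ^ ((2 * n + 1 + m) * i)) *
    andrewsCoeff q N n m

/-- The quantity whose differences in `n` account for the failure of `andrewsTerm` to satisfy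
Andrews' recurrence term by term. -/
def andrewsDefect (q : R) (N k i m n : ℕ) : R :=
  (-1) ^ n * q ^ (m * k * n + k * n ^ 2 + (k - i - 1) * n) * (1 - q ^ n) * andrewsCoeff q N n m

variable {q : R} {N : ℕ}

theorem andrewsCoeff_succ_right (hq : q ^ N = 0) (n m : ℕ) :
    (1 + q ^ (n + m + 1)) * andrewsCoeff q N n (m + 1) =
      (1 - q ^ (n + m + 1)) * andrewsCoeff q N n m := by
  rw [andrewsCoeff, andrewsCoeff, qPochhammer_succ,
    qPochhammer_eq_one_sub_mul hq (-q ^ (n + m + 1)), ← add_assoc n m 1, neg_mul, ← pow_succ]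
  ring

theorem andrewsCoeff_succ_left (q : R) (N n m : ℕ) :
    (1 + q ^ (n + 1)) * andrewsCoeff q N n (m + 1) =
      (1 - q ^ (n + 1)) * andrewsCoeff q N (n + 1) m := by
  rw [andrewsCoeff, andrewsCoeff, qPochhammer_succ (-q), qPochhammer_succ' (q ^ (n + 1)),
    ← pow_succ, add_right_comm n 1 m, ← add_assoc n m 1]
  ring

theorem andrewsTerm_succ (hq : q ^ N = 0) {k i : ℕ} (hik : i < k) (m n : ℕ) :
    andrewsTerm q N k (i + 1) m n = andrewsTerm q N k i m n +
      q ^ ((m + 1) * i) * (andrewsTerm q N k (k - i) (m + 1) n +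
        q ^ (m + 1) * andrewsTerm q N k (k - i - 1) (m + 1) n) +
      (andrewsDefect q N k i m n - andrewsDefect q N k i m (n + 1)) := by
  obtain ⟨l, rfl⟩ := Nat.exists_eq_add_of_lt hik
  have hright := andrewsCoeff_succ_right hq n m
  have hleft := andrewsCoeff_succ_left q N n m
  simp only [andrewsTerm, andrewsDefect]
  rw [show i + l + 1 - (i + 1) = l by omega, show i + l + 1 - i - 1 = l by omega,
    show i + l + 1 - i = l + 1 by omega, show i + l + 1 - (l + 1) = i by omega,
    show i + l + 1 - l = i + 1 by omega]
  linear_combination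
    (-(-1) ^ n * q ^ (m * (i + l + 1) * n + (i + l + 1) * n ^ 2 + l * n) *
      q ^ (n + (2 * n + 1 + m) * i)) * hright +
    ((-1) ^ n * q ^ (m * (i + l + 1) * (n + 1) + (i + l + 1) * (n + 1) ^ 2 + l * (n + 1))) * hleft

theorem satisfiesAndrewsRecurrence_sum_andrewsTerm (hq : q ^ N = 0) (k : ℕ) :
    SatisfiesAndrewsRecurrence q k
      fun i m => ∑ n ∈ range (N + 1), andrewsTerm q N k i m n where
  zero_left m := sum_eq_zero fun n _ => by
    rw [andrewsTerm, mul_zero, pow_zero, sub_self, mul_zero, zero_mul]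
  succ_left {i} hik m := by
    have hfirst : andrewsDefect q N k i m 0 = 0 := by
      rw [andrewsDefect, pow_zero q, sub_self, mul_zero, zero_mul]
    have hlast : andrewsDefect q N k i m (N + 1) = 0 := by
      have hexp : N ≤ m * k * (N + 1) + k * (N + 1) ^ 2 + (k - i - 1) * (N + 1) := by
        nlinarith [Nat.zero_le (m * k * (N + 1)), Nat.zero_le ((k - i - 1) * (N + 1)),
          Nat.zero_le i]
      rw [andrewsDefect, pow_eq_zero_of_le hexp hq, mul_zero, zero_mul, zero_mul]
    rw [sum_congr rfl fun n _ => andrewsTerm_succ hq hik m n, sum_add_distrib, sum_range_sub',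
      hfirst, hlast, sub_zero, add_zero, sum_add_distrib, ← mul_sum, sum_add_distrib, ← mul_sum]

theorem sum_andrewsTerm_last (hq : q ^ N = 0) {k i : ℕ} (hi : 1 ≤ i) (hik : i ≤ k) :
    ∑ n ∈ range (N + 1), andrewsTerm q N k i N n = qPochhammer q q N := by
  rw [sum_range_succ', sum_eq_zero, zero_add]
  · have hpow : q ^ ((2 * 0 + 1 + N) * i) = 0 := pow_eq_zero_of_le (by nlinarith) hq
    rw [andrewsTerm, hpow, andrewsCoeff, qPochhammer_zero, zero_add, zero_add, pow_succ q N, hq]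
    simp [qPochhammer_zero_left]
  · intro n _
    have hexp : N ≤ N * k * (n + 1) + k * (n + 1) ^ 2 + (k - i) * (n + 1) := by
      have : 1 ≤ k * (n + 1) := Nat.mul_pos (hi.trans hik) n.succ_pos
      nlinarith
    rw [andrewsTerm, pow_eq_zero_of_le hexp hq, mul_zero, zero_mul, zero_mul]

theorem sum_andrewsTerm_zero (hq : q ^ N = 0) {k i : ℕ} (hk : 1 ≤ k) (hik : i ≤ k) :
    ∑ n ∈ range (N + 1), andrewsTerm q N k i 0 n =
      qPochhammer (-q) q N * (qPochhammer (q ^ i) (q ^ (2 * k)) N *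
        qPochhammer (q ^ (2 * k - i)) (q ^ (2 * k)) N *
          qPochhammer (q ^ (2 * k)) (q ^ (2 * k)) N) := by
  have hcoeff (n : ℕ) : andrewsCoeff q N n 0 = qPochhammer (-q) q N := by
    rw [andrewsCoeff, qPochhammer_zero, mul_one,
      ← qPochhammer_eq_of_le hq (Nat.le_add_left N n) (-q), qPochhammer_add,
      add_zero, pow_succ', neg_mul]
  have hchoose (n : ℕ) : n ^ 2 = 2 * n.choose 2 + n := by
    rw [Nat.choose_two_right, Nat.two_mul_div_two_of_even (Nat.even_mul_pred_self n),
      Nat.mul_sub_one, Nat.sub_add_cancel n.le_mul_self, sq]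
  obtain ⟨l, rfl⟩ := Nat.exists_eq_add_of_le hik
  have hsplit : q ^ (2 * (i + l)) = q ^ i * q ^ (2 * (i + l) - i) := by
    rw [← pow_add, Nat.add_sub_cancel' (by omega)]
  rw [hsplit, qPochhammer_triple_product, mul_sum]
  · refine sum_congr rfl fun n _ => ?_
    rw [andrewsTerm, hcoeff, thetaTerm_neg, thetaTerm_natCast, ← Nat.cast_add_one,
      thetaTerm_natCast, mul_comm (q ^ (2 * (i + l) - i)), ← hsplit,
      show 2 * (i + l) - i = i + 2 * l by omega, Nat.add_sub_cancel_left, hchoose,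
      Nat.choose_succ_succ' n 1, Nat.choose_one_right]
    ring
  · rw [← hsplit, ← pow_mul]
    exact pow_eq_zero_of_le (Nat.le_mul_of_pos_left N (by omega)) hq

theorem SatisfiesAndrewsRecurrence.qPochhammer_mul_eq {g : ℕ → ℕ → R} {k i : ℕ}
    (hg : SatisfiesAndrewsRecurrence q k g) (hq : q ^ N = 0)
    (hlast : ∀ i, 1 ≤ i → i ≤ k → g i N = 1) (hk : 1 ≤ k) (hik : i ≤ k) :
    qPochhammer q q N * g i 0 = qPochhammer (-q) q N * (qPochhammer (q ^ i) (q ^ (2 * k)) N *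
      qPochhammer (q ^ (2 * k - i)) (q ^ (2 * k)) N *
        qPochhammer (q ^ (2 * k)) (q ^ (2 * k)) N) := by
  rw [← sum_andrewsTerm_zero hq hk hik]
  refine (hg.const_mul _).eq_of_eq (satisfiesAndrewsRecurrence_sum_andrewsTerm hq k) ?_
    (Nat.zero_le N) hik
  intro i hi hik
  rw [hlast i hi hik, mul_one, sum_andrewsTerm_last hq hi hik]

end AndrewsRecurrence

namespace Overpartition

section Multisets

variable {n : ℕ}

/-- The sum of a multiset of parts. -/
def weight (s : Multiset (ℕ × Bool)) : ℕ := (s.map Prod.fst).sum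

theorem weight_add (s t : Multiset (ℕ × Bool)) : weight (s + t) = weight s + weight t := by
  simp only [weight, Multiset.map_add, Multiset.sum_add]

theorem weight_replicate (c : ℕ) (p : ℕ × Bool) : weight (Multiset.replicate c p) = c * p.1 := by
  simp only [weight, Multiset.map_replicate, Multiset.sum_replicate, smul_eq_mul]

theorem weight_singleton (p : ℕ × Bool) : weight {p} = p.1 := by
  rw [← Multiset.replicate_one, weight_replicate, one_mul]

/-- The multisets of parts in which the non-overlined parts belong to `A`, and the overlined parts
belong to `B` and are distinct. -/
def partsIn (A B : Set ℕ) : Set (Multiset (ℕ × Bool)) :=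
  {s | (∀ a, (a, false) ∈ s → a ∈ A) ∧ (∀ a, (a, true) ∈ s → a ∈ B) ∧ ∀ a, s.count (a, true) ≤ 1}

theorem partsIn_mono {A A' B B' : Set ℕ} (hA : A ⊆ A') (hB : B ⊆ B') :
    partsIn A B ⊆ partsIn A' B' :=
  fun _ hs => ⟨fun a ha => hA (hs.1 a ha), fun a ha => hB (hs.2.1 a ha), hs.2.2⟩

theorem zero_mem_partsIn (A B : Set ℕ) : 0 ∈ partsIn A B := by
  simp [partsIn]

theorem mem_partsIn_of_le {A B : Set ℕ} {s t : Multiset (ℕ × Bool)} (hs : s ∈ partsIn A B)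
    (hle : t ≤ s) : t ∈ partsIn A B :=
  ⟨fun a ha => hs.1 a (Multiset.mem_of_le hle ha), fun a ha => hs.2.1 a (Multiset.mem_of_le hle ha),
    fun a => (Multiset.count_le_of_le _ hle).trans (hs.2.2 a)⟩

theorem mem_partsIn_Ioi {m : ℕ} {s : Multiset (ℕ × Bool)} : s ∈ partsIn (Set.Ioi m) (Set.Ioi m) ↔
    (∀ p ∈ s, m < p.1) ∧ ∀ a, s.count (a, true) ≤ 1 := by
  simp only [partsIn, Set.mem_ofPred_eq, Set.mem_Ioi, Prod.forall, Bool.forall_bool, forall_and,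
    and_assoc]

/-- The position of a part in the order in which sizes are compared first and an overlined part
exceeds the non-overlined part of the same size. -/
def rank (p : ℕ × Bool) : ℕ := 2 * p.1 + p.2.toNat

theorem rank_injective : Function.Injective rank := by
  rintro ⟨a, _ | _⟩ ⟨b, _ | _⟩ h <;> simp only [rank, Bool.toNat_false, Bool.toNat_true] at h <;>
    grind

/-- The order in which the parts of an overpartition are written. -/
def RankGE (p q : ℕ × Bool) : Prop := rank q ≤ rank p

instance : DecidableRel RankGE := fun _ _ => Nat.decLe _ _

instance : Std.Total RankGE := ⟨fun _ _ => Nat.le_total _ _⟩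

instance : IsTrans (ℕ × Bool) RankGE := ⟨fun _ _ _ hpq hqr => Nat.le_trans hqr hpq⟩

instance : Std.Antisymm RankGE := ⟨fun _ _ hpq hqp => rank_injective (Nat.le_antisymm hqp hpq)⟩

theorem pairwise_rankGE (o : Overpartition n) : o.parts.Pairwise RankGE := by
  refine (o.sorted.and o.overlined_first).imp fun {p q} ⟨hle, hfirst⟩ => ?_
  have hp := Bool.toNat_le p.2
  have hq := Bool.toNat_le q.2
  simp only [RankGE, rank]
  rcases hle.lt_or_eq with hlt | heq
  · omega
  · simp [hfirst heq.symm, heq]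

theorem coe_parts_injective :
    Function.Injective fun o : Overpartition n => (o.parts : Multiset (ℕ × Bool)) :=
  fun o₁ o₂ h => Overpartition.ext
    ((Multiset.coe_eq_coe.mp h).eq_of_pairwise' o₁.pairwise_rankGE o₂.pairwise_rankGE)

theorem two_le_count_coe_iff (p : ℕ × Bool) (l : List (ℕ × Bool)) :
    2 ≤ (l : Multiset (ℕ × Bool)).count p ↔ [p, p].Sublist l := by
  rw [Multiset.le_count_iff_replicate_le, Multiset.replicate_le_coe]
  rfl

theorem coe_parts_mem_partsIn (o : Overpartition n) :
    (o.parts : Multiset (ℕ × Bool)) ∈ partsIn (Set.Ioi 0) (Set.Ioi 0) := by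
  refine mem_partsIn_Ioi.mpr ⟨o.pos, fun a => ?_⟩
  by_contra! htwice
  have hpair := o.overlined_first.sublist ((two_le_count_coe_iff _ _).mp htwice)
  simp at hpair

theorem exists_coe_parts_eq {s : Multiset (ℕ × Bool)}
    (hs : s ∈ partsIn (Set.Ioi 0) (Set.Ioi 0)) :
    ∃ o : Overpartition (weight s), (o.parts : Multiset (ℕ × Bool)) = s := by
  obtain ⟨hpos, hcount⟩ := mem_partsIn_Ioi.mp hs
  have hsort : (s.sort RankGE).Pairwise RankGE := Multiset.pairwise_sort _ _
  refine ⟨⟨s.sort RankGE, fun p hp => hpos p ((Multiset.mem_sort _).mp hp),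
    hsort.imp fun {p q} h => ?_, ?_, ?_⟩, Multiset.sort_eq _ _⟩
  · have := Bool.toNat_le p.2
    simp only [RankGE, rank] at h
    omega
  · rw [List.pairwise_iff_forall_sublist] at hsort ⊢
    rintro ⟨a, x⟩ ⟨b, _ | _⟩ hsub heq
    · rfl
    obtain rfl : a = b := heq
    have hrank := hsort hsub
    cases x
    · simp [RankGE, rank] at hrank
    · have htwice := (two_le_count_coe_iff _ _).mpr hsub
      rw [Multiset.sort_eq] at htwice
      exact absurd (hcount a) (by omega)
  · conv_rhs => rw [← Multiset.sort_eq s RankGE, weight, Multiset.map_coe, Multiset.sum_coe]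

theorem weight_coe_parts (o : Overpartition n) : weight (o.parts : Multiset (ℕ × Bool)) = n := by
  rw [weight, Multiset.map_coe, Multiset.sum_coe, o.sum_eq]

/-- The multisets of `S` of weight `n`. -/
def ofWeight (S : Set (Multiset (ℕ × Bool))) (n : ℕ) : Set (Multiset (ℕ × Bool)) :=
  {s ∈ S | weight s = n}

theorem range_coe_parts (n : ℕ) :
    Set.range (fun o : Overpartition n => (o.parts : Multiset (ℕ × Bool))) =
      ofWeight (partsIn (Set.Ioi 0) (Set.Ioi 0)) n := by
  ext s
  constructor
  · rintro ⟨o, rfl⟩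
    exact ⟨o.coe_parts_mem_partsIn, o.weight_coe_parts⟩
  · rintro ⟨hs, rfl⟩
    exact exists_coe_parts_eq hs

theorem finite_ofWeight {S : Set (Multiset (ℕ × Bool))}
    (hS : S ⊆ partsIn (Set.Ioi 0) (Set.Ioi 0)) (n : ℕ) : (ofWeight S n).Finite := by
  have hfin := Set.finite_range fun o : Overpartition n => (o.parts : Multiset (ℕ × Bool))
  rw [range_coe_parts] at hfin
  exact hfin.subset fun _ hs => ⟨hS hs.1, hs.2⟩

theorem card_subtype_eq_ncard_ofWeight {P : Overpartition n → Prop}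
    {S : Set (Multiset (ℕ × Bool))} (hS : S ⊆ partsIn (Set.Ioi 0) (Set.Ioi 0))
    (h : ∀ o, P o ↔ (o.parts : Multiset (ℕ × Bool)) ∈ S) :
    Nat.card {o // P o} = (ofWeight S n).ncard := by
  have himage : ofWeight S n =
      (fun o : Overpartition n => (o.parts : Multiset (ℕ × Bool))) '' {o | P o} := by
    ext s
    constructor
    · rintro ⟨hs, hn⟩
      obtain ⟨o, rfl⟩ := (range_coe_parts n).ge ⟨hS hs, hn⟩
      exact ⟨o, (h o).mpr hs, rfl⟩
    · rintro ⟨o, ho, rfl⟩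
      exact ⟨(h o).mp ho, o.weight_coe_parts⟩
  rw [himage, Set.ncard_image_of_injective _ coe_parts_injective]
  rfl

end Multisets

section GeneratingFunction

variable {S T : Set (Multiset (ℕ × Bool))}

/-- The generating function, by weight, of a class of multisets of parts. It is meaningful for
subclasses of `partsIn (Set.Ioi 0) (Set.Ioi 0)`, which have finitely many members of each weight. -/
noncomputable def genFun (S : Set (Multiset (ℕ × Bool))) : ℤ⟦X⟧ :=
  PowerSeries.mk fun n => ((ofWeight S n).ncard : ℤ)

theorem coeff_genFun (S : Set (Multiset (ℕ × Bool))) (n : ℕ) :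
    coeff n (genFun S) = ((ofWeight S n).ncard : ℤ) :=
  coeff_mk _ _

theorem genFun_empty : genFun ∅ = 0 := by
  ext n
  simp [coeff_genFun, ofWeight]

theorem genFun_image_add (S : Set (Multiset (ℕ × Bool))) (u : Multiset (ℕ × Bool)) :
    genFun ((· + u) '' S) = X ^ weight u * genFun S := by
  ext n
  rw [coeff_X_pow_mul', coeff_genFun]
  split_ifs with hle
  · have himage : ofWeight ((· + u) '' S) n = (· + u) '' ofWeight S (n - weight u) := by
      ext s
      constructor
      · rintro ⟨⟨t, ht, rfl⟩, hn⟩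
        exact ⟨t, ⟨ht, Nat.eq_sub_of_add_eq (weight_add t u ▸ hn)⟩, rfl⟩
      · rintro ⟨t, ⟨ht, hn⟩, rfl⟩
        exact ⟨⟨t, ht, rfl⟩, by rw [weight_add, hn, Nat.sub_add_cancel hle]⟩
    rw [himage, Set.ncard_image_of_injective _ (add_left_injective u), coeff_genFun]
  · have hempty : ofWeight ((· + u) '' S) n = ∅ := by
      refine Set.eq_empty_of_forall_notMem ?_
      rintro _ ⟨⟨t, -, rfl⟩, rfl⟩
      exact hle (weight_add t u ▸ Nat.le_add_left _ _)
    rw [hempty, Set.ncard_empty, Nat.cast_zero]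

theorem genFun_eq_add_image (hS : S ⊆ partsIn (Set.Ioi 0) (Set.Ioi 0)) (u : Multiset (ℕ × Bool)) :
    genFun S = genFun {s ∈ S | ¬u ≤ s} + X ^ weight u * genFun {t | t + u ∈ S} := by
  have himage : (· + u) '' {t | t + u ∈ S} = {s ∈ S | u ≤ s} := by
    ext s
    constructor
    · rintro ⟨t, ht, rfl⟩
      exact ⟨ht, Multiset.le_add_left u t⟩
    · rintro ⟨hs, hu⟩
      exact ⟨s - u, by rwa [Set.mem_ofPred_eq, Multiset.sub_add_cancel hu],
        Multiset.sub_add_cancel hu⟩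
  rw [← genFun_image_add, himage]
  ext n
  rw [map_add, coeff_genFun, coeff_genFun, coeff_genFun, ← Nat.cast_add,
    ← Set.ncard_union_eq ?_ (finite_ofWeight ((Set.sep_subset _ _).trans hS) n)
      (finite_ofWeight ((Set.sep_subset _ _).trans hS) n)]
  · congr 2
    ext s
    by_cases hu : u ≤ s <;> simp [ofWeight, hu]
  · exact Set.disjoint_left.mpr fun s hs hs' => hs.1.2 hs'.1.2

theorem X_pow_dvd_genFun_sub_one {m : ℕ} (hS : S ⊆ partsIn (Set.Ioi m) (Set.Ioi m))
    (hzero : 0 ∈ S) : X ^ (m + 1) ∣ genFun S - 1 := by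
  rw [X_pow_dvd_iff]
  intro n hn
  have hweight : ofWeight S n = if n = 0 then {0} else ∅ := by
    have eq_zero {s : Multiset (ℕ × Bool)} (hs : s ∈ ofWeight S n) : s = 0 := by
      refine Multiset.eq_zero_of_forall_notMem fun p hp => ?_
      have hlt := (mem_partsIn_Ioi.mp (hS hs.1)).1 p hp
      have hle : p.1 ≤ n := hs.2 ▸ Multiset.le_sum_of_mem (Multiset.mem_map_of_mem Prod.fst hp)
      omega
    split_ifs with hn0
    · exact Set.Subset.antisymm (fun s hs => eq_zero hs) (by simp [ofWeight, hzero, hn0, weight])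
    · refine Set.eq_empty_of_forall_notMem fun s hs => hn0 ?_
      rw [← hs.2, eq_zero hs]
      rfl
  rw [map_sub, coeff_genFun, coeff_one, hweight]
  split_ifs <;> simp

theorem map_genFun_eq_one {R : Type*} [CommRing R] (φ : ℤ⟦X⟧ →+* R) {m N : ℕ}
    (hφ : φ X ^ N = 0) (hNm : N ≤ m + 1) (hS : S ⊆ partsIn (Set.Ioi m) (Set.Ioi m))
    (hzero : 0 ∈ S) : φ (genFun S) = 1 := by
  obtain ⟨f, hf⟩ := X_pow_dvd_genFun_sub_one hS hzero
  rw [← sub_eq_zero, ← map_one φ, ← map_sub, hf, map_mul, map_pow, pow_eq_zero_of_le hNm hφ,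
    zero_mul]

end GeneratingFunction

section DifferenceClass

/-- The multisets of parts greater than `m` in which `m + 1` occurs less than `i` times as a
non-overlined part, and which satisfy the difference condition for `k`, expressed through
multiplicities. -/
def differenceClass (k i m : ℕ) : Set (Multiset (ℕ × Bool)) :=
  {s ∈ partsIn (Set.Ioi m) (Set.Ioi m) | s.count (m + 1, false) < i ∧
    ∀ a, s.count (a + 1, false) + s.count (a, false) + s.count (a, true) < k}

theorem differenceClass_subset (k i m : ℕ) :
    differenceClass k i m ⊆ partsIn (Set.Ioi m) (Set.Ioi m) :=
  Set.sep_subset _ _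

theorem differenceClass_subset_Ioi_zero (k i m : ℕ) :
    differenceClass k i m ⊆ partsIn (Set.Ioi 0) (Set.Ioi 0) :=
  (differenceClass_subset k i m).trans
    (partsIn_mono (Set.Ioi_subset_Ioi m.zero_le) (Set.Ioi_subset_Ioi m.zero_le))

theorem differenceClass_zero (k m : ℕ) : differenceClass k 0 m = ∅ :=
  Set.eq_empty_of_forall_notMem fun _ hs => Nat.not_lt_zero _ hs.2.1

theorem zero_mem_differenceClass {k i : ℕ} (hi : 0 < i) (hk : 0 < k) (m : ℕ) :
    0 ∈ differenceClass k i m :=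
  ⟨zero_mem_partsIn _ _, by simpa, by simpa⟩

theorem differenceClass_succ_sep_not_le {k i : ℕ} (m : ℕ) :
    {s ∈ differenceClass k (i + 1) m | ¬Multiset.replicate i (m + 1, false) ≤ s} =
      differenceClass k i m := by
  ext s
  simp only [differenceClass, Set.mem_ofPred_eq, ← Multiset.le_count_iff_replicate_le, not_le]
  grind

theorem add_replicate_mem_differenceClass_succ_iff {k i m : ℕ} (hik : i < k)
    {t : Multiset (ℕ × Bool)} :
    t + Multiset.replicate i (m + 1, false) ∈ differenceClass k (i + 1) m ∧ (m + 1, true) ∉ t ↔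
      t ∈ differenceClass k (k - i) (m + 1) := by
  simp only [differenceClass, partsIn, Set.mem_ofPred_eq, Multiset.count_add,
    Multiset.count_replicate, ← Multiset.count_pos, Prod.mk.injEq, reduceCtorEq, and_true,
    and_false, if_false, add_zero, Set.mem_Ioi]
  constructor
  · rintro ⟨⟨⟨hfalse, htrue, hdistinct⟩, hfirst, hdiff⟩, hnotMem⟩
    refine ⟨⟨?_, ?_, ?_⟩, ?_, ?_⟩ <;> grind
  · rintro ⟨⟨hfalse, htrue, hdistinct⟩, hfirst, hdiff⟩
    refine ⟨⟨⟨?_, ?_, ?_⟩, ?_, ?_⟩, ?_⟩ <;> grind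

theorem add_singleton_add_replicate_mem_differenceClass_succ_iff {k i m : ℕ} (hik : i < k)
    {t : Multiset (ℕ × Bool)} :
    t + {(m + 1, true)} + Multiset.replicate i (m + 1, false) ∈ differenceClass k (i + 1) m ↔
      t ∈ differenceClass k (k - i - 1) (m + 1) := by
  simp only [differenceClass, partsIn, Set.mem_ofPred_eq, Multiset.count_add,
    Multiset.count_singleton, Multiset.count_replicate, ← Multiset.count_pos, Prod.mk.injEq,
    reduceCtorEq, and_true, and_false, if_false, add_zero, Set.mem_Ioi]
  constructor
  · rintro ⟨⟨hfalse, htrue, hdistinct⟩, hfirst, hdiff⟩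
    refine ⟨⟨?_, ?_, ?_⟩, ?_, ?_⟩ <;> grind
  · rintro ⟨⟨hfalse, htrue, hdistinct⟩, hfirst, hdiff⟩
    refine ⟨⟨?_, ?_, ?_⟩, ?_, ?_⟩ <;> grind

theorem satisfiesAndrewsRecurrence_genFun_differenceClass (k : ℕ) :
    SatisfiesAndrewsRecurrence X k fun i m => genFun (differenceClass k i m) where
  zero_left m := by rw [differenceClass_zero, genFun_empty]
  succ_left {i} hik m := by
    set S := {t | t + Multiset.replicate i (m + 1, false) ∈ differenceClass k (i + 1) m} with hS
    have hSsub : S ⊆ partsIn (Set.Ioi 0) (Set.Ioi 0) := fun t ht =>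
      mem_partsIn_of_le (differenceClass_subset_Ioi_zero _ _ _ ht) (Multiset.le_add_right _ _)
    have hwithout : {t ∈ S | ¬{(m + 1, true)} ≤ t} = differenceClass k (k - i) (m + 1) := by
      simp only [Multiset.singleton_le, hS, Set.mem_ofPred_eq]
      exact Set.ext fun t => add_replicate_mem_differenceClass_succ_iff hik
    have hwith : {t | t + {(m + 1, true)} ∈ S} = differenceClass k (k - i - 1) (m + 1) :=
      Set.ext fun t => add_singleton_add_replicate_mem_differenceClass_succ_iff hik
    rw [genFun_eq_add_image (differenceClass_subset_Ioi_zero k (i + 1) m),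
      differenceClass_succ_sep_not_le, ← hS, genFun_eq_add_image hSsub, hwithout, hwith,
      weight_replicate, weight_singleton, mul_comm i]

end DifferenceClass

section PartsIn

variable {A B : Set ℕ}

theorem genFun_partsIn_mul_one_sub (hA : A ⊆ Set.Ioi 0) (hB : B ⊆ Set.Ioi 0) {a : ℕ}
    (ha : a ∈ A) : genFun (partsIn A B) * (1 - X ^ a) = genFun (partsIn (A \ {a}) B) := by
  have hwithout : {s ∈ partsIn A B | ¬{(a, false)} ≤ s} = partsIn (A \ {a}) B := by
    ext s
    simp only [partsIn, Multiset.singleton_le, Set.mem_ofPred_eq, Set.mem_sdiff,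
      Set.mem_singleton_iff]
    grind
  have hwith : {t | t + {(a, false)} ∈ partsIn A B} = partsIn A B := by
    ext t
    simp only [partsIn, Set.mem_ofPred_eq, Multiset.mem_add, Multiset.mem_singleton,
      Multiset.count_add, Multiset.count_singleton]
    grind
  have hsplit := genFun_eq_add_image (partsIn_mono hA hB) {(a, false)}
  rw [hwithout, hwith, weight_singleton] at hsplit
  linear_combination hsplit

theorem genFun_partsIn_eq_one_add_mul (hA : A ⊆ Set.Ioi 0) (hB : B ⊆ Set.Ioi 0) {b : ℕ}
    (hb : b ∈ B) : genFun (partsIn A B) = (1 + X ^ b) * genFun (partsIn A (B \ {b})) := by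
  have hwithout : {s ∈ partsIn A B | ¬{(b, true)} ≤ s} = partsIn A (B \ {b}) := by
    ext s
    simp only [partsIn, Multiset.singleton_le, Set.mem_ofPred_eq, Set.mem_sdiff,
      Set.mem_singleton_iff]
    grind
  have hwith : {t | t + {(b, true)} ∈ partsIn A B} = partsIn A (B \ {b}) := by
    ext t
    simp only [partsIn, Set.mem_ofPred_eq, Set.mem_sdiff, Set.mem_singleton_iff,
      Multiset.count_add, Multiset.count_singleton, ← Multiset.count_pos]
    grind
  rw [genFun_eq_add_image (partsIn_mono hA hB) {(b, true)}, hwithout, hwith, weight_singleton,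
    add_mul, one_mul]

theorem genFun_partsIn_mul_prod (hA : A ⊆ Set.Ioi 0) (hB : B ⊆ Set.Ioi 0) {F : Finset ℕ}
    (hF : (F : Set ℕ) ⊆ A) :
    genFun (partsIn A B) * ∏ a ∈ F, (1 - X ^ a) = genFun (partsIn (A \ F) B) := by
  induction F using Finset.induction_on with
  | empty => simp
  | insert a F haF ih =>
    rw [coe_insert, Set.insert_subset_iff] at hF
    rw [prod_insert haF, mul_comm (1 - X ^ a), ← mul_assoc, ih hF.2,
      genFun_partsIn_mul_one_sub (Set.sdiff_subset.trans hA) hB ⟨hF.1, by simpa⟩,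
      Set.sdiff_sdiff, coe_insert, Set.union_singleton]

theorem genFun_partsIn_eq_prod_mul (hA : A ⊆ Set.Ioi 0) (hB : B ⊆ Set.Ioi 0) {F : Finset ℕ}
    (hF : (F : Set ℕ) ⊆ B) :
    genFun (partsIn A B) = (∏ b ∈ F, (1 + X ^ b)) * genFun (partsIn A (B \ F)) := by
  induction F using Finset.induction_on with
  | empty => simp
  | insert b F hbF ih =>
    rw [coe_insert, Set.insert_subset_iff] at hF
    rw [prod_insert hbF, ih hF.2,
      genFun_partsIn_eq_one_add_mul hA (Set.sdiff_subset.trans hB) ⟨hF.1, by simpa⟩,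
      Set.sdiff_sdiff, coe_insert, Set.union_singleton, ← mul_assoc, mul_comm (1 + X ^ b)]

theorem map_genFun_partsIn_mul_prod {R : Type*} [CommRing R] (φ : ℤ⟦X⟧ →+* R) {N L : ℕ}
    (hφ : φ X ^ N = 0) (hNL : N ≤ L) (hA : A ⊆ Set.Ioi 0) (hB : B ⊆ Set.Ioi 0)
    [DecidablePred (· ∈ A)] [DecidablePred (· ∈ B)] :
    φ (genFun (partsIn A B)) * ∏ a ∈ Icc 1 L with a ∈ A, (1 - φ X ^ a) =
      ∏ b ∈ Icc 1 L with b ∈ B, (1 + φ X ^ b) := by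
  have diff_subset {C : Set ℕ} [DecidablePred (· ∈ C)] (hC : C ⊆ Set.Ioi 0) :
      C \ ({c ∈ Icc 1 L | c ∈ C} : Finset ℕ) ⊆ Set.Ioi L := by
    rintro c ⟨hcC, hcL⟩
    have hpos : 1 ≤ c := hC hcC
    simpa [hcC, hpos] using hcL
  have htrunc := map_genFun_eq_one φ hφ (hNL.trans L.le_succ)
    (partsIn_mono (diff_subset hA) (diff_subset hB)) (zero_mem_partsIn _ _)
  have hprod := congrArg φ <| genFun_partsIn_mul_prod hA hB (F := {a ∈ Icc 1 L | a ∈ A})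
    fun a ha => (mem_filter.mp ha).2
  rw [genFun_partsIn_eq_prod_mul (Set.sdiff_subset.trans hA) hB (F := {b ∈ Icc 1 L | b ∈ B})
    fun b hb => (mem_filter.mp hb).2] at hprod
  simpa only [map_mul, map_prod, map_sub, map_add, map_one, map_pow, htrunc, mul_one] using hprod

theorem qPochhammer_mul_map_genFun_partsIn_sdiff {R : Type*} [CommRing R] (φ : ℤ⟦X⟧ →+* R)
    {N L : ℕ} (hφ : φ X ^ N = 0) (hNL : N ≤ L) (A B : Set ℕ) [DecidablePred (· ∈ A)]
    [DecidablePred (· ∈ B)] :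
    qPochhammer (φ X) (φ X) N * φ (genFun (partsIn (Set.Ioi 0 \ A) (Set.Ioi 0 \ B))) *
        ∏ b ∈ Icc 1 L with b ∈ B, (1 + φ X ^ b) =
      qPochhammer (-φ X) (φ X) N * ∏ a ∈ Icc 1 L with a ∈ A, (1 - φ X ^ a) := by
  have filter_sdiff (C : Set ℕ) [DecidablePred (· ∈ C)] :
      {c ∈ Icc 1 L | c ∈ Set.Ioi 0 \ C} = {c ∈ Icc 1 L | c ∉ C} :=
    filter_congr fun c hc => and_iff_right (mem_Icc.mp hc).1
  have hgen := map_genFun_partsIn_mul_prod φ hφ hNL (Set.sdiff_subset (s := Set.Ioi 0) (t := A))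
    (Set.sdiff_subset (s := Set.Ioi 0) (t := B))
  have hsub := prod_filter_mul_prod_filter_not (Icc 1 L) (· ∈ A) fun a => 1 - φ X ^ a
  have hadd := prod_filter_mul_prod_filter_not (Icc 1 L) (· ∈ B) fun b => 1 + φ X ^ b
  rw [filter_sdiff, filter_sdiff] at hgen
  rw [prod_Icc_one_sub_pow, qPochhammer_eq_of_le hφ hNL] at hsub
  rw [prod_Icc_one_add_pow, qPochhammer_eq_of_le hφ hNL] at hadd
  rw [← hsub, ← hadd]
  linear_combination (∏ a ∈ Icc 1 L with a ∈ A, (1 - φ X ^ a)) *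
    (∏ b ∈ Icc 1 L with b ∈ B, (1 + φ X ^ b)) * hgen

end PartsIn

section CongruenceClass

/-- The multisets of parts that satisfy the congruence condition for `k` and `i`. The residue
classes of `0` and `-i` modulo `2 * k` are represented by `2 * k` and `2 * k - i`. -/
def congruenceClass (k i : ℕ) : Set (Multiset (ℕ × Bool)) :=
  if i = k then
    partsIn (Set.Ioi 0 \ {a | a ≡ k [MOD k]}) (Set.Ioi 0 \ {a | a ≡ k [MOD k]})
  else
    partsIn (Set.Ioi 0 \
      {a | a ≡ i [MOD 2 * k] ∨ a ≡ 2 * k - i [MOD 2 * k] ∨ a ≡ 2 * k [MOD 2 * k]}) (Set.Ioi 0)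

theorem congruenceClass_subset (k i : ℕ) :
    congruenceClass k i ⊆ partsIn (Set.Ioi 0) (Set.Ioi 0) := by
  unfold congruenceClass
  split_ifs
  · exact partsIn_mono Set.sdiff_subset Set.sdiff_subset
  · exact partsIn_mono Set.sdiff_subset le_rfl

variable {R : Type*} [CommRing R] (φ : ℤ⟦X⟧ →+* R) {k N : ℕ}

theorem qPochhammer_mul_map_genFun_congruenceClass_of_lt (hφ : φ X ^ N = 0) {i : ℕ} (hi : 1 ≤ i)
    (hik : i < k) : qPochhammer (φ X) (φ X) N * φ (genFun (congruenceClass k i)) =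
      qPochhammer (-φ X) (φ X) N * (qPochhammer (φ X ^ i) (φ X ^ (2 * k)) N *
        qPochhammer (φ X ^ (2 * k - i)) (φ X ^ (2 * k)) N *
        qPochhammer (φ X ^ (2 * k)) (φ X ^ (2 * k)) N) := by
  have hgen := qPochhammer_mul_map_genFun_partsIn_sdiff φ hφ
    (Nat.le_mul_of_pos_left N (by omega : 0 < 2 * k))
    {a | a ≡ i [MOD 2 * k] ∨ a ≡ 2 * k - i [MOD 2 * k] ∨ a ≡ 2 * k [MOD 2 * k]} ∅
  simp only [Set.sdiff_empty, Set.mem_empty_iff_false, filter_false, prod_empty, mul_one,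
    Set.mem_ofPred_eq, prod_modEq_or_one_sub_pow _ hi hik] at hgen
  rw [congruenceClass, if_neg hik.ne, hgen]

theorem qPochhammer_mul_map_genFun_congruenceClass_self (hφ : φ X ^ N = 0) (hk : 1 ≤ k) :
    qPochhammer (φ X) (φ X) N * φ (genFun (congruenceClass k k)) =
      qPochhammer (-φ X) (φ X) N * (qPochhammer (φ X ^ k) (φ X ^ (2 * k)) N *
        qPochhammer (φ X ^ (2 * k - k)) (φ X ^ (2 * k)) N *
        qPochhammer (φ X ^ (2 * k)) (φ X ^ (2 * k)) N) := by
  have hφk : (φ X ^ k) ^ N = 0 := by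
    rw [← pow_mul]
    exact pow_eq_zero_of_le (Nat.le_mul_of_pos_left N hk) hφ
  have hgen := qPochhammer_mul_map_genFun_partsIn_sdiff φ hφ (Nat.le_mul_of_pos_left N hk)
    {a | a ≡ k [MOD k]} {a | a ≡ k [MOD k]}
  simp only [Set.mem_ofPred_eq] at hgen
  rw [prod_modEq_one_sub_pow _ hk le_rfl, prod_modEq_one_add_pow _ hk le_rfl,
    qPochhammer_self_eq_mul hφk, ← pow_mul, mul_comm k 2] at hgen
  have heuler := qPochhammer_neg_self_mul_odd hφk
  rw [← pow_mul, mul_comm k 2] at heuler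
  rw [congruenceClass, if_pos rfl, show 2 * k - k = k by omega]
  linear_combination qPochhammer (φ X ^ k) (φ X ^ (2 * k)) N * hgen -
    qPochhammer (φ X) (φ X) N * φ (genFun _) * heuler

theorem qPochhammer_mul_map_genFun_congruenceClass (hφ : φ X ^ N = 0) {i : ℕ} (hi : 1 ≤ i)
    (hik : i ≤ k) : qPochhammer (φ X) (φ X) N * φ (genFun (congruenceClass k i)) =
      qPochhammer (-φ X) (φ X) N * (qPochhammer (φ X ^ i) (φ X ^ (2 * k)) N *
        qPochhammer (φ X ^ (2 * k - i)) (φ X ^ (2 * k)) N *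
        qPochhammer (φ X ^ (2 * k)) (φ X ^ (2 * k)) N) := by
  rcases hik.eq_or_lt with rfl | hlt
  · exact qPochhammer_mul_map_genFun_congruenceClass_self φ hφ hi
  · exact qPochhammer_mul_map_genFun_congruenceClass_of_lt φ hφ hi hlt

theorem map_genFun_congruenceClass_eq_differenceClass (hφ : φ X ^ N = 0) {i : ℕ} (hi : 1 ≤ i)
    (hik : i ≤ k) : φ (genFun (congruenceClass k i)) = φ (genFun (differenceClass k i 0)) := by
  have hlast (j : ℕ) (hj : 1 ≤ j) (_ : j ≤ k) : φ (genFun (differenceClass k j N)) = 1 :=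
    map_genFun_eq_one φ hφ N.le_succ (differenceClass_subset k j N)
      (zero_mem_differenceClass hj (hi.trans hik) N)
  have hdiff := ((satisfiesAndrewsRecurrence_genFun_differenceClass k).map φ).qPochhammer_mul_eq
    hφ hlast (hi.trans hik) hik
  have hcong := qPochhammer_mul_map_genFun_congruenceClass φ hφ hi hik
  exact (isUnit_qPochhammer ⟨N, hφ⟩ _ N).mul_left_cancel (hcong.trans hdiff.symm)

theorem genFun_congruenceClass_eq_differenceClass {i : ℕ} (hi : 1 ≤ i) (hik : i ≤ k) :
    genFun (congruenceClass k i) = genFun (differenceClass k i 0) := by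
  ext n
  have hX : Ideal.Quotient.mk (Ideal.span {(X : ℤ⟦X⟧) ^ (n + 1)}) X ^ (n + 1) = 0 := by
    rw [← map_pow, Ideal.Quotient.eq_zero_iff_mem]
    exact Ideal.mem_span_singleton_self _
  have hmod := map_genFun_congruenceClass_eq_differenceClass _ hX hi hik
  rw [Ideal.Quotient.eq, Ideal.mem_span_singleton, X_pow_dvd_iff] at hmod
  rw [← sub_eq_zero, ← map_sub, hmod n n.lt_succ_self]

end CongruenceClass

end Overpartition

section Window

variable {α β : Type*} [LinearOrder β] {key : α → β} {l : List α} {m : ℕ} {lo hi : β}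

theorem exists_mem_drop_of_lt_countP {p : α → Bool} (h : m < l.countP p) :
    ∃ x ∈ l.drop m, p x := by
  rw [← List.countP_pos_iff]
  rw [← List.take_append_drop m l, List.countP_append] at h
  have htake := (List.countP_le_length (p := p) (l := l.take m)).trans (List.length_take_le m l)
  omega

theorem getElem_le_of_pairwise_ge (hl : l.Pairwise fun x y => key y ≤ key x) {a b : ℕ}
    (hab : a ≤ b) (hb : b < l.length) : key l[b] ≤ key l[a] := by
  rcases hab.eq_or_lt with rfl | hlt
  · rfl
  · exact List.pairwise_iff_getElem.mp hl a b _ hb hlt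

theorem exists_window_of_lt_countP (hl : l.Pairwise fun x y => key y ≤ key x)
    (hcount : m < l.countP fun x => lo ≤ key x ∧ key x ≤ hi) :
    ∃ (j : ℕ) (h : j + m < l.length), key l[j] ≤ hi ∧ lo ≤ key l[j + m] := by
  induction l with
  | nil => simp at hcount
  | cons x l ih =>
    by_cases hx : key x ≤ hi
    · obtain ⟨y, hy, hyp⟩ := exists_mem_drop_of_lt_countP hcount
      obtain ⟨b, hb, rfl⟩ := List.getElem_of_mem hy
      rw [List.length_drop] at hb
      rw [List.getElem_drop, decide_eq_true_iff] at hyp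
      have hlo := hyp.1.trans (getElem_le_of_pairwise_ge hl (m.le_add_right b) (by omega))
      exact ⟨0, by omega, hx, by simpa only [zero_add] using hlo⟩
    · rw [List.countP_cons_of_neg (by simp [hx])] at hcount
      obtain ⟨j, h, hj⟩ := ih hl.of_cons hcount
      exact ⟨j + 1, by grind, by simpa [Nat.add_right_comm j 1 m] using hj⟩

theorem lt_countP_of_window (hl : l.Pairwise fun x y => key y ≤ key x) {j : ℕ}
    (h : j + m < l.length) (hhi : key l[j] ≤ hi) (hlo : lo ≤ key l[j + m]) :
    m < l.countP fun x => lo ≤ key x ∧ key x ≤ hi := by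
  have hwindow : ((l.drop j).take (m + 1)).countP (fun x => lo ≤ key x ∧ key x ≤ hi) = m + 1 := by
    rw [List.countP_eq_length.mpr, List.length_take, List.length_drop]
    · omega
    · intro x hx
      obtain ⟨b, hb, rfl⟩ := List.getElem_of_mem hx
      rw [List.length_take, List.length_drop] at hb
      simpa using ⟨hlo.trans (getElem_le_of_pairwise_ge hl (by omega) h),
        (getElem_le_of_pairwise_ge hl (by omega) _).trans hhi⟩
  rw [← Nat.add_one_le_iff, ← hwindow]
  exact ((List.take_sublist _ _).trans (List.drop_sublist _ _)).countP_le

theorem lt_countP_iff_exists_window (hl : l.Pairwise fun x y => key y ≤ key x) :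
    (m < l.countP fun x => lo ≤ key x ∧ key x ≤ hi) ↔
      ∃ (j : ℕ) (h : j + m < l.length), key l[j] ≤ hi ∧ lo ≤ key l[j + m] :=
  ⟨exists_window_of_lt_countP hl, fun ⟨_, h, hhi, hlo⟩ => lt_countP_of_window hl h hhi hlo⟩

end Window

namespace Overpartition

section Conditions

variable {k i n : ℕ}

theorem count_coe (p : ℕ × Bool) (l : List (ℕ × Bool)) :
    (l : Multiset (ℕ × Bool)).count p = l.count p := by
  -- `List.count` uses the `BEq` instance of products here, `Multiset.count` decidable equality.
  rw [Multiset.count, Multiset.coe_countP, List.count]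
  exact List.countP_congr fun x _ => by simpa using eq_comm

theorem count_add_count_add_count_eq_countP (a : ℕ) (l : List (ℕ × Bool)) :
    l.count (a + 1, false) + l.count (a, false) + l.count (a, true) =
      l.countP fun p => 2 * a ≤ rank p ∧ rank p ≤ 2 * a + 2 := by
  induction l with
  | nil => simp
  | cons p l ih =>
    have hone : (if p == (a + 1, false) then 1 else 0) + (if p == (a, false) then 1 else 0) +
        (if p == (a, true) then 1 else 0) =
          if 2 * a ≤ rank p ∧ rank p ≤ 2 * a + 2 then 1 else 0 := by
      rcases p with ⟨b, _ | _⟩ <;> simp only [rank] <;> grind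
    rw [List.countP_cons, ← ih, List.count_cons, List.count_cons, List.count_cons]
    simp only [decide_eq_true_eq, ← hone]
    ring

theorem size_sub_size_ge_iff (p p' : ℕ × Bool) :
    (p.1 : ℤ) - p'.1 ≥ (if p.2 = true then 1 else 2) ↔
      ∀ a, rank p ≤ 2 * a + 2 → rank p' < 2 * a := by
  have hp := Bool.toNat_le p.2
  have hp' := Bool.toNat_le p'.2
  simp only [rank]
  constructor
  · intro hsub a ha
    split_ifs at hsub with htrue
    · simp only [htrue, Bool.toNat_true] at ha
      omega
    · omega
  · intro hrank
    have hsize := hrank p'.1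
    split_ifs with htrue
    · simp only [htrue, Bool.toNat_true] at hsize
      omega
    · simp only [htrue, Bool.toNat_false] at hsize
      omega

theorem differenceCondition_iff (hi : 1 ≤ i) (hik : i ≤ k) (o : Overpartition n) :
    o.DifferenceCondition k i ↔ (o.parts : Multiset (ℕ × Bool)) ∈ differenceClass k i 0 := by
  have hwindow (a : ℕ) :
      (o.parts.countP fun p => 2 * a ≤ rank p ∧ rank p ≤ 2 * a + 2) < k ↔
        ∀ (j : ℕ) (h : j + (k - 1) < o.parts.length),
          rank o.parts[j] ≤ 2 * a + 2 → rank o.parts[j + (k - 1)] < 2 * a := by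
    rw [← Nat.le_sub_one_iff_lt (hi.trans hik), ← not_lt,
      lt_countP_iff_exists_window o.pairwise_rankGE]
    simp only [not_exists, not_and, not_le]
  simp only [differenceClass, Set.mem_ofPred_eq, o.coe_parts_mem_partsIn, true_and, count_coe,
    count_add_count_add_count_eq_countP, hwindow, DifferenceCondition, size_sub_size_ge_iff,
    zero_add, Nat.le_sub_one_iff_lt hi]
  exact and_congr_right fun _ => ⟨fun h a j hj => h j hj a, fun h j hj a => h a j hj⟩

theorem intCast_modEq_neg_iff (hik : i ≤ k) (a : ℕ) :
    (a : ℤ) ≡ -i [ZMOD k] ↔ a ≡ k - i [MOD k] := by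
  have hneg : (-i : ℤ) ≡ (k - i : ℕ) [ZMOD k] := by
    rw [Nat.cast_sub hik]
    simp [sub_eq_neg_add]
  rw [← Int.natCast_modEq_iff]
  exact ⟨fun h => h.trans hneg, fun h => h.trans hneg.symm⟩

theorem coe_parts_mem_partsIn_sdiff_iff (o : Overpartition n) (A B : Set ℕ) :
    (o.parts : Multiset (ℕ × Bool)) ∈ partsIn (Set.Ioi 0 \ A) (Set.Ioi 0 \ B) ↔
      (∀ a, (a, false) ∈ o.parts → a ∉ A) ∧ ∀ a, (a, true) ∈ o.parts → a ∉ B := by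
  obtain ⟨hfalse, htrue, hdistinct⟩ := o.coe_parts_mem_partsIn
  simp only [Multiset.mem_coe] at hfalse htrue
  simp only [partsIn, Set.mem_ofPred_eq, Set.mem_sdiff, Multiset.mem_coe]
  grind

theorem congruenceCondition_iff (hik : i ≤ k) (o : Overpartition n) :
    o.CongruenceCondition k i ↔ (o.parts : Multiset (ℕ × Bool)) ∈ congruenceClass k i := by
  rw [CongruenceCondition, congruenceClass]
  split_ifs
  · have hdvd (a : ℕ) : a ≡ k [MOD k] ↔ k ∣ a := by
      rw [Nat.ModEq, Nat.mod_self, Nat.dvd_iff_mod_eq_zero]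
    simp [coe_parts_mem_partsIn_sdiff_iff, hdvd, forall_and]
  · have hmod (a : ℕ) : (¬(a : ℤ) ≡ 0 [ZMOD 2 * k] ∧ ¬(a : ℤ) ≡ i [ZMOD 2 * k] ∧
        ¬(a : ℤ) ≡ -i [ZMOD 2 * k]) ↔
          ¬(a ≡ i [MOD 2 * k] ∨ a ≡ 2 * k - i [MOD 2 * k] ∨ a ≡ 2 * k [MOD 2 * k]) := by
      have hzero := intCast_modEq_neg_iff (2 * k).zero_le a
      have hpos := Int.natCast_modEq_iff (a := a) (b := i) (n := 2 * k)
      have hneg := intCast_modEq_neg_iff (hik.trans (Nat.le_mul_of_pos_left k two_pos)) a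
      push_cast [neg_zero, Nat.sub_zero] at hzero hpos hneg
      tauto
    have hmem := o.coe_parts_mem_partsIn_sdiff_iff
      {a | a ≡ i [MOD 2 * k] ∨ a ≡ 2 * k - i [MOD 2 * k] ∨ a ≡ 2 * k [MOD 2 * k]} ∅
    rw [Set.sdiff_empty] at hmem
    simp [hmod, hmem]

end Conditions

end Overpartition

theorem theorem1p4 (k i : ℕ) (hi : 1 ≤ i) (hik : i ≤ k) (n : ℕ) :
    Overpartition.countC k i n = Overpartition.countD k i n := by
  have hcard := congrArg (coeff n) (Overpartition.genFun_congruenceClass_eq_differenceClass hi hik)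
  rw [Overpartition.coeff_genFun, Overpartition.coeff_genFun, Nat.cast_inj] at hcard
  rwa [Overpartition.countC, Overpartition.countD,
    Overpartition.card_subtype_eq_ncard_ofWeight (Overpartition.congruenceClass_subset k i)
      (Overpartition.congruenceCondition_iff hik),
    Overpartition.card_subtype_eq_ncard_ofWeight
      (Overpartition.differenceClass_subset_Ioi_zero k i 0)
      (Overpartition.differenceCondition_iff hi hik)]
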